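/- **Setting.** Let $S,A$ be finite nonempty sets, $\gamma\in[0,1)$ and $p_0$ a distribution on $S$. A discounted MDP $\phi$ (with these fixed $S,A,\gamma,p_0$) is given by next-state distributions $P_\phi(\cdot|s,a)\in\Delta(S)$ and reward distributions $q_\phi(\cdot|s,a)\in\Delta([0,1])$ with means $r_\phi(s,a)$. A policy is a map $\pi:S\to\Delta(A)$, with value $V_\phi^\pi(s)=\mathbb{E}_\phi^\pi[\sum_{t\ge 0}\gamma^t r_\phi(s_t,a_t)\mid s_0=s]$; let $V^\star_\phi=\max_\pi V_\phi^\pi$ and $\Pi^\star_\varepsilon(\phi)=\{\pi:\|V^\pi_\phi-V^\star_\phi\|_\infty\le\varepsilon\}$. The MDP is communicating if for all $s,s'\in S$ there is a deterministic policy under which $s'$ is accessible from $s$. Write $\phi\ll\psi$ if $P_\phi(\cdot|s,a)\ll P_\psi(\cdot|s,a)$ and $q_\phi(\cdot|s,a)\ll q_\psi(\cdot|s,a)$ for all $(s,a)$, and put $$\mathrm{Alt}_\varepsilon(\phi)=\{\psi:\phi\ll\psi,\ \Pi^\star_\varepsilon(\phi)\cap\Pi^\star_\varepsilon(\psi)=\emptyset\},$$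 $$\mathrm{KL}_{\phi|\psi}(s,a)=\mathrm{KL}(P_\phi(\cdot|s,a),P_\psi(\cdot|s,a))+\mathrm{KL}(q_\phi(\cdot|s,a),q_\psi(\cdot|s,a))\in[0,\infty].$$ **Algorithms.** Under the generative model, in each round the learner chooses a pair $(s,a)$, as a function of her past observations and of internal randomness, and observes an independent next state $s'\sim P_\phi(\cdot|s,a)$ and reward $r\sim q_\phi(\cdot|s,a)$. An algorithm consists of such a sampling rule, a stopping time $\tau\in\{0,1,2,\dots\}\cup\{\infty\}$ with respect to the filtration $(\mathcal F_n)_{n\ge0}$ generated by the internal randomness and the first $n$ observations, and an $\mathcal F_\tau$-measurable recommended policy $\hat\pi$. It is called $(\delta,\varepsilon)$-PAC (at $\phi$) if $\mathbb{P}_\phi[\tau<\infty]=1$ and, for every communicating MDP $\psi$, $\mathbb{P}_\psi[\tau=\infty\text{ or }\hat\pi\in\Pi^\star_\varepsilon(\psi)]\ge1-\delta$. In particular this holds if, under every communicating MDP $\psi$, it stops almost surely and $\mathbb{P}_\psi[\hat\pi\in\Pi^\star_\varepsilon(\psi)]\ge 1-\delta$. **Theorem.** Let $\varepsilon\ge0$,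 $\delta\in(0,1/2]$, and let $\phi$ be a communicating MDP, not necessarily with a unique optimal policy. Then every $(\delta,\varepsilon)$-PAC algorithm under the generative model satisfies $$\mathbb{E}_\phi[\tau]\ \ge\ T_\varepsilon\,\mathrm{kl}(\delta,1-\delta),$$ where $\mathrm{kl}(a,b)=a\log\frac ab+(1-a)\log\frac{1-a}{1-b}$, $$T_\varepsilon=\inf_{\omega\in\Delta(S\times A)}T_\varepsilon(\omega),\qquad T_\varepsilon(\omega)^{-1}=\inf_{\psi\in\mathrm{Alt}_\varepsilon(\phi)}\ \sum_{(s,a)\in S\times A}\omega(s,a)\,\mathrm{KL}_{\phi|\psi}(s,a),$$ equivalently $T_\varepsilon^{-1}=\sup_\omega\inf_{\psi\in\mathrm{Alt}_\varepsilon(\phi)}\sum_{s,a}\omega(s,a)\mathrm{KL}_{\phi|\psi}(s,a)$. All quantities are in $[0,\infty]$, with $0\cdot\infty=0$, $1/0=\infty$, $1/\infty=0$ and $\inf\emptyset=\infty$. -/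

import Mathlib

open MeasureTheory ProbabilityTheory
open scoped ENNReal

noncomputable section

/-! ### Discounted Markov decision processes -/

/-- The finite discounted MDPs with state space `S`, action space `A`, discount factor `γ ∈ [0,1)`
and initial distribution `p₀`. Two elements of `MDP S A γ p₀` share these data and differ in their
transition probabilities and in their reward distributions, which are supported in `[0,1]`. -/
structure MDP (S A : Type*) [MeasurableSpace S] (γ : Set.Ico (0 : ℝ) 1)
    (p₀ : ProbabilityMeasure S) where
  /-- distribution of the next state, for each pair (state, action) -/
  P : S × A → ProbabilityMeasure S
  /-- distribution of the reward, for each pair (state, action) -/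
  q : S × A → ProbabilityMeasure unitInterval

/-- Stationary Markovian policies `π : S → Δ(A)`. -/
abbrev Policy (S A : Type*) [Fintype A] : Type _ := S → stdSimplex ℝ A

namespace MDP

variable {S A : Type*} [Fintype S] [Fintype A] [MeasurableSpace S]
  {γ : Set.Ico (0 : ℝ) 1} {p₀ : ProbabilityMeasure S}

/-- The average reward `r(s,a)`. -/
def reward (φ : MDP S A γ p₀) (z : S × A) : ℝ :=
  ∫ x, (x : ℝ) ∂(φ.q z : Measure unitInterval)

/-- The probability `P(s' | s, a)`. -/
def trans (φ : MDP S A γ p₀) (z : S × A) (s' : S) : ℝ :=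
  (φ.P z : Measure S).real {s'}

open Classical in
/-- `φ.stateLaw π s t x` is the probability that `s_t = x` when `s_0 = s` and `π` is followed. -/
def stateLaw (φ : MDP S A γ p₀) (π : Policy S A) (s : S) : ℕ → S → ℝ
  | 0 => fun x => if x = s then 1 else 0
  | t + 1 => fun x => ∑ y, φ.stateLaw π s t y * ∑ a, (π y).1 a * φ.trans (y, a) x

/-- The discounted value `V^π(s) = ∑_t γ^t 𝔼[r(s_t,a_t) | s_0 = s]`. -/
def value (φ : MDP S A γ p₀) (π : Policy S A) (s : S) : ℝ :=
  ∑' t : ℕ, (γ : ℝ) ^ t * ∑ x, ∑ a, φ.stateLaw π s t x * (π x).1 a * φ.reward (x, a)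

/-- The optimal value `V^⋆(s)`, the largest value of a policy. -/
def optValue (φ : MDP S A γ p₀) (s : S) : ℝ :=
  ⨆ π : Policy S A, φ.value π s

/-- The set of `ε`-optimal policies (the norm is the sup norm on `S → ℝ`). -/
def epsOptimal (φ : MDP S A γ p₀) (ε : ℝ) : Set (Policy S A) :=
  {π | ‖φ.value π - φ.optValue‖ ≤ ε}

/-- For every `s` and `s'` there is a deterministic policy under which `s'` is accessible
from `s`. -/
def Communicating (φ : MDP S A γ p₀) : Prop :=
  ∀ s s' : S, ∃ d : S → A, Relation.ReflTransGen (fun x y => 0 < φ.trans (x, d x) y) s s'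

/-- `φ ≪ ψ`. -/
def AbsCont (φ ψ : MDP S A γ p₀) : Prop :=
  ∀ z : S × A, (φ.P z : Measure S) ≪ (ψ.P z : Measure S) ∧
    (φ.q z : Measure unitInterval) ≪ (ψ.q z : Measure unitInterval)

/-- The confusing MDPs: those `ψ` with `φ ≪ ψ` that have no `ε`-optimal policy in common
with `φ`. -/
def altSet (φ : MDP S A γ p₀) (ε : ℝ) : Set (MDP S A γ p₀) :=
  {ψ | φ.AbsCont ψ ∧ φ.epsOptimal ε ∩ ψ.epsOptimal ε = ∅}

/-- `KL_{φ|ψ}(s,a)`, with values in `[0,∞]`. -/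
def KL (φ ψ : MDP S A γ p₀) (z : S × A) : ℝ≥0∞ :=
  InformationTheory.klDiv (φ.P z : Measure S) (ψ.P z : Measure S) +
    InformationTheory.klDiv (φ.q z : Measure unitInterval) (ψ.q z : Measure unitInterval)

/-- The characteristic time `T_ε(ω)` of the allocation `ω`, with
`T_ε(ω)⁻¹ = inf_{ψ ∈ Alt_ε(φ)} 𝔼_{(s,a) ∼ ω}[KL_{φ|ψ}(s,a)]` in `[0,∞]`. -/
def charTime (φ : MDP S A γ p₀) (ε : ℝ) (ω : stdSimplex ℝ (S × A)) : ℝ≥0∞ :=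
  (⨅ ψ ∈ φ.altSet ε, ∑ z, ENNReal.ofReal (ω.1 z) * φ.KL ψ z)⁻¹

/-- The optimal characteristic time `T_ε`, the least one over all allocations; equivalently,
`T_ε⁻¹` is the supremum over `ω` of `T_ε(ω)⁻¹`. -/
def optCharTime (φ : MDP S A γ p₀) (ε : ℝ) : ℝ≥0∞ :=
  ⨅ ω : stdSimplex ℝ (S × A), φ.charTime ε ω

end MDP

/-- The Kullback-Leibler divergence `kl(a,b)` between Bernoulli distributions of means
`a, b ∈ (0,1)`. -/
def klBernoulli (a b : ℝ) : ℝ :=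
  a * Real.log (a / b) + (1 - a) * Real.log ((1 - a) / (1 - b))

/-! ### Interaction under the generative model

The sample space is `W × (ℕ → S × A → S × [0,1])`. The first component is the internal randomness
of the learner. The entry of the second one at a round `n` and a pair `z` is the (next state, reward)
that the generative model returns if the learner queries `z` in round `n`. All entries are
independent, and only the queried ones are revealed to the learner. -/

/-- The record of one round: the queried pair (state, action), the next state, the reward. -/
abbrev Round (S A : Type*) : Type _ := (S × A) × (S × unitInterval)

/-- The sample space of the interaction. -/
abbrev SampleSpace (W S A : Type*) : Type _ := W × (ℕ → S × A → S × unitInterval)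

/-- A sampling rule: the pair queried in round `n`, as a function of the internal randomness and
of the records of the previous rounds. -/
structure SamplingRule (W S A : Type*) [MeasurableSpace W] [MeasurableSpace S]
    [MeasurableSpace A] where
  query : (n : ℕ) → W × (Fin n → Round S A) → S × A
  measurable_query : ∀ n, Measurable (query n)

namespace SamplingRule

variable {W S A : Type*} [MeasurableSpace W] [MeasurableSpace S] [MeasurableSpace A]

/-- The records of the first `n` rounds. -/
def history (ρ : SamplingRule W S A) : (n : ℕ) → SampleSpace W S A → Fin n → Round S A
  | 0, _ => Fin.elim0
  | n + 1, x =>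
    let z := ρ.query n (x.1, ρ.history n x)
    Fin.snoc (α := fun _ => Round S A) (ρ.history n x) (z, x.2 n z)

lemma measurable_history [Finite S] [Finite A] [MeasurableSingletonClass S]
    [MeasurableSingletonClass A] (ρ : SamplingRule W S A) (n : ℕ) :
    Measurable (ρ.history n) := by
  induction n with
  | zero => exact measurable_pi_lambda _ fun i => i.elim0
  | succ n ih =>
    have hz : Measurable fun x : SampleSpace W S A => ρ.query n (x.1, ρ.history n x) :=
      (ρ.measurable_query n).comp (measurable_fst.prodMk ih)
    have hev : Measurable fun p : SampleSpace W S A × (S × A) => p.1.2 n p.2 :=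
      measurable_from_prod_countable_left fun z =>
        (measurable_pi_apply z).comp ((measurable_pi_apply n).comp measurable_snd)
    have hy : Measurable fun x : SampleSpace W S A =>
        x.2 n (ρ.query n (x.1, ρ.history n x)) :=
      hev.comp (measurable_id.prodMk hz)
    refine measurable_pi_lambda _ fun i => ?_
    refine Fin.lastCases ?_ (fun j => ?_) i
    · simpa [history] using hz.prodMk hy
    · simpa [history, Function.comp_def] using (measurable_pi_apply j).comp ih

/-- The filtration of the learner's information: at time `n` she knows her internal randomness and
the records of the first `n` rounds. -/
def filtration [Finite S] [Finite A] [MeasurableSingletonClass S] [MeasurableSingletonClass A]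
    (ρ : SamplingRule W S A) :
    Filtration ℕ (inferInstance : MeasurableSpace (SampleSpace W S A)) where
  seq n := MeasurableSpace.comap (fun x => (x.1, ρ.history n x)) inferInstance
  mono' := by
    refine monotone_nat_of_le_succ fun n => ?_
    have h : (fun x : SampleSpace W S A => (x.1, ρ.history n x)) =
        (fun p : W × (Fin (n + 1) → Round S A) => (p.1, fun i : Fin n => p.2 i.castSucc)) ∘
          (fun x => (x.1, ρ.history (n + 1) x)) := by
      funext x
      simp [history]
    rw [h, ← MeasurableSpace.comap_comp]
    refine MeasurableSpace.comap_mono (Measurable.comap_le ?_)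
    exact measurable_fst.prodMk (measurable_pi_lambda _ fun i =>
      (measurable_pi_apply _).comp measurable_snd)
  le' n := (measurable_fst.prodMk (ρ.measurable_history n)).comap_le

end SamplingRule

/-- A learning algorithm under the generative model: the law of its internal randomness, a sampling
rule, a stopping time `τ` (the number of samples), and a recommended policy that is measurable
with respect to the information at time `τ`. -/
structure GenAlgorithm (W S A : Type*) [MeasurableSpace W] [Fintype S] [MeasurableSpace S]
    [MeasurableSingletonClass S] [Fintype A] [MeasurableSpace A]
    [MeasurableSingletonClass A] where
  seedLaw : ProbabilityMeasure W
  rule : SamplingRule W S A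
  τ : SampleSpace W S A → ℕ∞
  isStoppingTime : IsStoppingTime rule.filtration τ
  recommend : SampleSpace W S A → Policy S A
  measurable_recommend : Measurable[isStoppingTime.measurableSpace] recommend

namespace GenAlgorithm

variable {W S A : Type*} [MeasurableSpace W] [Fintype S] [MeasurableSpace S]
  [MeasurableSingletonClass S] [Fintype A] [MeasurableSpace A] [MeasurableSingletonClass A]
  {γ : Set.Ico (0 : ℝ) 1} {p₀ : ProbabilityMeasure S}

/-- The law `ℙ_φ` on the sample space. -/
def law (alg : GenAlgorithm W S A) (φ : MDP S A γ p₀) : Measure (SampleSpace W S A) :=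
  (alg.seedLaw : Measure W).prod
    (Measure.infinitePi fun _ : ℕ => Measure.pi fun z : S × A =>
      (φ.P z : Measure S).prod (φ.q z : Measure unitInterval))

/-- The algorithm is `(δ,ε)`-PAC, with termination required at `φ`: it stops almost surely under
`φ`, and under every communicating MDP `ψ`, which the learner cannot rule out in advance, its
recommendation is `ε`-optimal with probability at least `1 - δ`, where a run that does not stop is
not counted as an error. -/
structure IsPAC (alg : GenAlgorithm W S A) (δ ε : ℝ) (φ : MDP S A γ p₀) : Prop where
  stops : ∀ᵐ x ∂(alg.law φ), alg.τ x ≠ ⊤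
  correct : ∀ ψ : MDP S A γ p₀, ψ.Communicating →
    ENNReal.ofReal (1 - δ) ≤ alg.law ψ {x | alg.τ x = ⊤ ∨ alg.recommend x ∈ ψ.epsOptimal ε}

/-- An algorithm that stops almost surely, with an `ε`-optimal recommendation with probability at
least `1 - δ`, under every communicating MDP is PAC in the above sense. -/
lemma IsPAC.of_forall {alg : GenAlgorithm W S A} {δ ε : ℝ} {φ : MDP S A γ p₀}
    (hφ : φ.Communicating)
    (h : ∀ ψ : MDP S A γ p₀, ψ.Communicating → (∀ᵐ x ∂(alg.law ψ), alg.τ x ≠ ⊤) ∧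
      ENNReal.ofReal (1 - δ) ≤ alg.law ψ {x | alg.recommend x ∈ ψ.epsOptimal ε}) :
    alg.IsPAC δ ε φ where
  stops := (h φ hφ).1
  correct ψ hψ := (h ψ hψ).2.trans (measure_mono fun _ hx => Or.inr hx)

/-- The sample complexity `𝔼_φ[τ]`, in `[0,∞]`. -/
def sampleComplexity (alg : GenAlgorithm W S A) (φ : MDP S A γ p₀) : ℝ≥0∞ :=
  ∫⁻ x, (alg.τ x : ℝ≥0∞) ∂(alg.law φ)

end GenAlgorithm

end

/-!
# An information-theoretic lower bound for best policy identification

Fix `ψ ∈ Alt_ε(φ)`. Since `φ ≪ ψ`, the MDP `ψ` is communicating as well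
(`MDP.Communicating.of_absCont`), so the PAC guarantee holds at `φ` and at `ψ`. The event
`s = {π̂ ∈ Π⋆_ε(φ)}` therefore has probability at least `1 - δ` under `φ`, and
`s ∩ {τ < ∞}` has probability at most `δ` under `ψ`, because no policy is `ε`-optimal for both.
It is an event because the value is continuous in the policy (`MDP.continuous_value`).

Let `L` be the log-likelihood ratio of `φ` against `ψ` of the records up to time `τ`
(`GenAlgorithm.stoppedLog`). Two facts about `L` are used.

* Change of measure (`GenAlgorithm.setLIntegral_exp_neg_stoppedLog_le`): for an event `s` of the
  information at time `τ`, `𝔼_φ[exp(-L); s] ≤ ℙ_ψ(s, τ < ∞)`. Only an inequality holds in general,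
  since `ψ` may give mass to observations that are impossible under `φ`.
* Wald's identity (`GenAlgorithm.integral_stoppedLog`): `𝔼_φ[L] = ∑ z, 𝔼_φ[N_z] KL_{φ|ψ}(z)`, where
  `N_z` is the number of queries of `z` before `τ` (`GenAlgorithm.visits`).

Both rest on `GenAlgorithm.lintegral_info_record`: given the past, the record of round `n` consists
of the queried pair `z` and of a fresh sample of the law of the observations at `z`.

Integrating `1 + u ≤ exp u` at `u = ±c - L`, with `c = log ((1-δ)/δ)` and the sign `+` exactly
on `s`, gives `kl(δ, 1-δ) ≤ 𝔼_φ[L]` (`klBernoulli_le_integral`). This is the data processing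
inequality for the event `s` in the only instance needed. So
`kl(δ, 1-δ) ≤ ∑ z, 𝔼_φ[N_z] KL_{φ|ψ}(z)` for every confusing `ψ`, and as the `𝔼_φ[N_z]` sum to
`𝔼_φ[τ]`, the allocation `ω(z) = 𝔼_φ[N_z] / 𝔼_φ[τ]` witnesses the bound.
-/

/-! ### Transitions, and continuity of the value in the policy -/

lemma continuous_policy_apply {S A : Type*} [Fintype A] (x : S) (a : A) :
    Continuous fun π : Policy S A => (π x).1 a :=
  (continuous_apply a).comp (continuous_subtype_val.comp (continuous_apply x))

namespace MDP

section

variable {S A : Type*} [MeasurableSpace S] {γ : Set.Ico (0 : ℝ) 1} {p₀ : ProbabilityMeasure S}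

lemma trans_nonneg (φ : MDP S A γ p₀) (z : S × A) (x : S) : 0 ≤ φ.trans z x :=
  measureReal_nonneg

lemma sum_trans [Fintype S] [MeasurableSingletonClass S] (φ : MDP S A γ p₀) (z : S × A) :
    ∑ x, φ.trans z x = 1 := by
  have h := sum_measureReal_singleton (μ := (φ.P z : Measure S)) Finset.univ
  simpa [trans] using h

lemma abs_reward_le_one (φ : MDP S A γ p₀) (z : S × A) : |φ.reward z| ≤ 1 := by
  have h := norm_integral_le_of_norm_le_const (μ := (φ.q z : Measure unitInterval))
    (f := fun x => (x : ℝ)) (C := 1)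
    (Filter.Eventually.of_forall fun x => by
      rw [Real.norm_eq_abs, abs_of_nonneg x.2.1]; exact x.2.2)
  simpa [reward] using h

/-- A transition that is possible under `φ` is possible under every `ψ` with `φ ≪ ψ`, so a
confusing MDP of a communicating one is among those for which the PAC guarantee is required. -/
lemma Communicating.of_absCont {φ ψ : MDP S A γ p₀} (hφ : φ.Communicating) (h : φ.AbsCont ψ) :
    ψ.Communicating := by
  intro s s'
  obtain ⟨d, hd⟩ := hφ s s'
  refine ⟨d, Relation.ReflTransGen.mono (fun x y hxy => ?_) _ _ hd⟩
  refine lt_of_le_of_ne (ψ.trans_nonneg _ _) fun h0 => hxy.ne' ?_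
  have h1 : (ψ.P (x, d x) : Measure S) {y} = 0 := by
    simpa [trans, measureReal_def, ENNReal.toReal_eq_zero_iff] using h0.symm
  simp [trans, measureReal_def, (h (x, d x)).1 h1]

end

variable {S A : Type*} [Fintype S] [Fintype A] [MeasurableSpace S]
  {γ : Set.Ico (0 : ℝ) 1} {p₀ : ProbabilityMeasure S}

lemma stateLaw_nonneg (φ : MDP S A γ p₀) (π : Policy S A) (s : S) (t : ℕ) (x : S) :
    0 ≤ φ.stateLaw π s t x := by
  induction t generalizing x with
  | zero => simp only [stateLaw]; split_ifs <;> simp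
  | succ t ih =>
    exact Finset.sum_nonneg fun y _ => mul_nonneg (ih y) (Finset.sum_nonneg fun a _ =>
      mul_nonneg ((π y).2.1 a) (φ.trans_nonneg _ _))

lemma sum_stateLaw [MeasurableSingletonClass S] (φ : MDP S A γ p₀) (π : Policy S A) (s : S)
    (t : ℕ) :
    ∑ x, φ.stateLaw π s t x = 1 := by
  induction t with
  | zero => classical simp [stateLaw, Finset.sum_ite_eq']
  | succ t ih =>
    simp only [stateLaw]
    rw [Finset.sum_comm, ← ih]
    refine Finset.sum_congr rfl fun y _ => ?_
    rw [← Finset.mul_sum, Finset.sum_comm]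
    simp_rw [← Finset.mul_sum, sum_trans, mul_one]
    rw [(π y).2.2, mul_one]

lemma continuous_stateLaw (φ : MDP S A γ p₀) (s : S) (t : ℕ) (x : S) :
    Continuous fun π : Policy S A => φ.stateLaw π s t x := by
  induction t generalizing x with
  | zero => exact continuous_const
  | succ t ih =>
    simp only [stateLaw]
    refine continuous_finsetSum _ fun y _ => (ih y).mul (continuous_finsetSum _ fun a _ => ?_)
    exact (continuous_policy_apply y a).mul continuous_const

lemma abs_sum_stateLaw_mul_reward_le_one [MeasurableSingletonClass S]
    (φ : MDP S A γ p₀) (π : Policy S A) (s : S) (t : ℕ) :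
    |∑ x, ∑ a, φ.stateLaw π s t x * (π x).1 a * φ.reward (x, a)| ≤ 1 := by
  calc |∑ x, ∑ a, φ.stateLaw π s t x * (π x).1 a * φ.reward (x, a)|
      ≤ ∑ x, ∑ a, φ.stateLaw π s t x * (π x).1 a := by
        refine (Finset.abs_sum_le_sum_abs _ _).trans (Finset.sum_le_sum fun x _ => ?_)
        refine (Finset.abs_sum_le_sum_abs _ _).trans (Finset.sum_le_sum fun a _ => ?_)
        have h := mul_nonneg (φ.stateLaw_nonneg π s t x) ((π x).2.1 a)
        rw [abs_mul, abs_of_nonneg h]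
        exact mul_le_of_le_one_right h (φ.abs_reward_le_one _)
    _ = 1 := by
        simp_rw [← Finset.mul_sum]
        rw [← φ.sum_stateLaw π s t]
        exact Finset.sum_congr rfl fun x _ => by rw [(π x).2.2, mul_one]

/-- By the Weierstrass test: the `t`-th term of the discounted series is continuous in the policy
and at most `γ ^ t`. -/
lemma continuous_value [MeasurableSingletonClass S] (φ : MDP S A γ p₀) :
    Continuous fun π : Policy S A => φ.value π := by
  refine continuous_pi fun s => ?_
  refine continuous_tsum (u := fun t : ℕ => (γ : ℝ) ^ t) (fun t => ?_)
    (summable_geometric_of_lt_one γ.2.1 γ.2.2) fun t π => ?_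
  · refine continuous_const.mul (continuous_finsetSum _ fun x _ =>
      continuous_finsetSum _ fun a _ => ?_)
    exact ((φ.continuous_stateLaw s t x).mul (continuous_policy_apply x a)).mul continuous_const
  · rw [norm_mul, norm_pow, Real.norm_of_nonneg γ.2.1, Real.norm_eq_abs]
    exact mul_le_of_le_one_right (pow_nonneg γ.2.1 t)
      (φ.abs_sum_stateLaw_mul_reward_le_one π s t)

lemma measurableSet_epsOptimal [MeasurableSingletonClass S] (φ : MDP S A γ p₀) (ε : ℝ) :
    MeasurableSet (φ.epsOptimal ε) :=
  (isClosed_le (φ.continuous_value.sub continuous_const).norm continuous_const).measurableSet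

end MDP

/-! ### The law of one observation, and the likelihood ratio -/

/-- The Kullback-Leibler divergence is additive over products: apply the chain rule to constant
kernels. -/
lemma klDiv_prod {α β : Type*} {mα : MeasurableSpace α} {mβ : MeasurableSpace β}
    (μ ν : Measure α) (κ η : Measure β) [IsProbabilityMeasure μ] [IsProbabilityMeasure ν]
    [IsProbabilityMeasure κ] [IsProbabilityMeasure η] :
    InformationTheory.klDiv (μ.prod κ) (ν.prod η) =
      InformationTheory.klDiv μ ν + InformationTheory.klDiv κ η := by
  have hleft : InformationTheory.klDiv (κ.prod μ) (η.prod μ) = InformationTheory.klDiv κ η := by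
    rw [← Measure.compProd_const, ← Measure.compProd_const,
      InformationTheory.klDiv_compProd_left]
  have hswap : InformationTheory.klDiv (μ.prod κ) (μ.prod η) = InformationTheory.klDiv κ η := by
    rw [← hleft]
    refine le_antisymm ?_ ?_
    · simpa only [Measure.prod_swap] using
        InformationTheory.klDiv_map_le (μ := κ.prod μ) (ν := η.prod μ) measurable_swap
    · simpa only [Measure.prod_swap] using
        InformationTheory.klDiv_map_le (μ := μ.prod κ) (ν := μ.prod η) measurable_swap
  rw [← hswap, ← Measure.compProd_const, ← Measure.compProd_const, ← Measure.compProd_const,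
    InformationTheory.klDiv_compProd_eq_add]

namespace MDP

variable {S A : Type*} [MeasurableSpace S]
  {γ : Set.Ico (0 : ℝ) 1} {p₀ : ProbabilityMeasure S}

/-- The joint law of the next state and the reward returned for the pair `z`. -/
noncomputable def obs (φ : MDP S A γ p₀) (z : S × A) : Measure (S × unitInterval) :=
  (φ.P z : Measure S).prod (φ.q z : Measure unitInterval)

instance (φ : MDP S A γ p₀) (z : S × A) : IsProbabilityMeasure (φ.obs z) := by
  unfold obs; infer_instance

lemma AbsCont.obs {φ ψ : MDP S A γ p₀} (h : φ.AbsCont ψ) (z : S × A) : φ.obs z ≪ ψ.obs z :=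
  (h z).1.prod (h z).2

lemma klDiv_obs (φ ψ : MDP S A γ p₀) (z : S × A) :
    InformationTheory.klDiv (φ.obs z) (ψ.obs z) = φ.KL ψ z :=
  klDiv_prod _ _ _ _

lemma measurable_lintegral_obs [Finite S] [Finite A] [MeasurableSpace A]
    [MeasurableSingletonClass S] [MeasurableSingletonClass A] (φ : MDP S A γ p₀)
    {X : Type*} [MeasurableSpace X]
    {F : X × Round S A → ℝ≥0∞} (hF : Measurable F) :
    Measurable fun p : X × (S × A) => ∫⁻ y, F (p.1, (p.2, y)) ∂(φ.obs p.2) :=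
  measurable_from_prod_countable_left fun z => by
    have h : Measurable fun q : X × (S × unitInterval) => F (q.1, (z, q.2)) :=
      hF.comp (by fun_prop)
    exact h.lintegral_prod_right' (ν := φ.obs z)

/-- The likelihood ratio of `φ` against `ψ` of the record of one round, given the queried pair. -/
noncomputable def likelihoodRatio (φ ψ : MDP S A γ p₀) (p : Round S A) : ℝ≥0∞ :=
  (φ.obs p.1).rnDeriv (ψ.obs p.1) p.2

lemma measurable_likelihoodRatio [Finite S] [Finite A] [MeasurableSpace A]
    [MeasurableSingletonClass S] [MeasurableSingletonClass A] (φ ψ : MDP S A γ p₀) :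
    Measurable (φ.likelihoodRatio ψ) :=
  measurable_from_prod_countable_right fun z => Measure.measurable_rnDeriv (φ.obs z) (ψ.obs z)

/-- Weighting by the inverse likelihood ratio turns an expectation under `φ` into at most the one
under `ψ`; the part of `ψ` on which the density vanishes is lost. -/
lemma lintegral_inv_likelihoodRatio_mul_le {φ ψ : MDP S A γ p₀} (h : φ.AbsCont ψ) (z : S × A)
    {g : S × unitInterval → ℝ≥0∞} (hg : Measurable g) :
    ∫⁻ y, (φ.likelihoodRatio ψ (z, y))⁻¹ * g y ∂(φ.obs z) ≤ ∫⁻ y, g y ∂(ψ.obs z) := by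
  have hm : Measurable fun y => φ.likelihoodRatio ψ (z, y) :=
    Measure.measurable_rnDeriv (φ.obs z) (ψ.obs z)
  rw [← lintegral_rnDeriv_mul (h.obs z) (f := fun y => (φ.likelihoodRatio ψ (z, y))⁻¹ * g y)
    (hm.inv.mul hg).aemeasurable]
  refine lintegral_mono fun y => ?_
  change φ.likelihoodRatio ψ (z, y) * ((φ.likelihoodRatio ψ (z, y))⁻¹ * g y) ≤ g y
  rw [← mul_assoc]
  exact mul_le_of_le_one_left zero_le (ENNReal.mul_inv_le_one _)

lemma integral_log_likelihoodRatio {φ ψ : MDP S A γ p₀} (h : φ.AbsCont ψ) (z : S × A) :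
    ∫ y, Real.log (φ.likelihoodRatio ψ (z, y)).toReal ∂(φ.obs z) = (φ.KL ψ z).toReal := by
  rw [← klDiv_obs, InformationTheory.toReal_klDiv_of_measure_eq (h.obs z) (by simp)]
  rfl

lemma integrable_log_likelihoodRatio {φ ψ : MDP S A γ p₀} {z : S × A} (h : φ.KL ψ z ≠ ∞) :
    Integrable (fun y => Real.log (φ.likelihoodRatio ψ (z, y)).toReal) (φ.obs z) := by
  rw [← klDiv_obs, InformationTheory.klDiv_ne_top_iff] at h
  exact h.2

lemma ae_likelihoodRatio_pos {φ ψ : MDP S A γ p₀} (h : φ.AbsCont ψ) (z : S × A) :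
    ∀ᵐ y ∂(φ.obs z), 0 < (φ.likelihoodRatio ψ (z, y)).toReal := by
  filter_upwards [Measure.rnDeriv_pos (h.obs z),
    (h.obs z).ae_le (Measure.rnDeriv_lt_top (φ.obs z) (ψ.obs z))] with y h0 h1
  exact ENNReal.toReal_pos h0.ne' h1.ne

end MDP

/-! ### One step of the interaction -/

/-- Resampling one coordinate of an i.i.d. sequence does not change its law. -/
lemma infinitePi_map_update {X : Type*} [MeasurableSpace X] (m : Measure X)
    [IsProbabilityMeasure m] (n : ℕ) :
    ((Measure.infinitePi fun _ : ℕ => m).prod m).map (fun p => Function.update p.1 n p.2) =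
      Measure.infinitePi fun _ : ℕ => m := by
  refine Measure.eq_infinitePi _ fun s t ht => ?_
  have hmeas : Measurable fun p : (ℕ → X) × X => Function.update p.1 n p.2 := by fun_prop
  rw [Measure.map_apply hmeas (MeasurableSet.pi s.countable_toSet fun i _ => ht i)]
  have hpre : (fun p : (ℕ → X) × X => Function.update p.1 n p.2) ⁻¹' Set.pi s t =
      Set.pi (s.erase n) t ×ˢ (if n ∈ s then t n else Set.univ) := by
    ext p
    simp only [Set.mem_preimage, Set.mem_pi, Set.mem_prod, Finset.coe_erase, Set.mem_sdiff,
      SetLike.mem_coe, Set.mem_singleton_iff]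
    constructor
    · refine fun h => ⟨fun i hi => by simpa [hi.2] using h i hi.1, ?_⟩
      split_ifs with hn
      · simpa using h n hn
      · trivial
    · rintro ⟨h1, h2⟩ i hi
      by_cases hin : i = n
      · subst hin; simpa [hi] using h2
      · simpa [hin] using h1 i ⟨hi, hin⟩
  rw [hpre, Measure.prod_prod, Measure.infinitePi_pi _ fun i _ => ht i]
  split_ifs with hn
  · exact Finset.prod_erase_mul s (fun i => m (t i)) hn
  · rw [Finset.erase_eq_of_notMem hn, measure_univ, mul_one]

namespace SamplingRule

variable {W S A : Type*} [MeasurableSpace W] [MeasurableSpace S] [MeasurableSpace A]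

/-- What the learner knows at time `n`: her internal randomness and the first `n` records. -/
def info (ρ : SamplingRule W S A) (n : ℕ) (x : SampleSpace W S A) : W × (Fin n → Round S A) :=
  (x.1, ρ.history n x)

/-- The pair queried in round `n`. -/
def pair (ρ : SamplingRule W S A) (n : ℕ) (x : SampleSpace W S A) : S × A :=
  ρ.query n (ρ.info n x)

/-- The record of round `n`. -/
def record (ρ : SamplingRule W S A) (n : ℕ) (x : SampleSpace W S A) : Round S A :=
  (ρ.pair n x, x.2 n (ρ.pair n x))

lemma history_succ (ρ : SamplingRule W S A) (n : ℕ) (x : SampleSpace W S A) :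
    ρ.history (n + 1) x = Fin.snoc (α := fun _ => Round S A) (ρ.history n x) (ρ.record n x) :=
  rfl

lemma history_apply (ρ : SamplingRule W S A) (n : ℕ) (x : SampleSpace W S A) (i : Fin n) :
    ρ.history n x i = ρ.record i x := by
  induction n with
  | zero => exact i.elim0
  | succ n ih =>
    refine Fin.lastCases ?_ (fun j => ?_) i
    · simp [history_succ]
    · simp [history_succ, ih]

/-- The first `n` records do not depend on the answers prepared for later rounds. -/
lemma history_update (ρ : SamplingRule W S A) {n m : ℕ} (h : n ≤ m) (w : W)
    (y : ℕ → S × A → S × unitInterval) (v : S × A → S × unitInterval) :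
    ρ.history n (w, Function.update y m v) = ρ.history n (w, y) := by
  induction n with
  | zero => rfl
  | succ n ih =>
    have hne : n ≠ m := by omega
    simp only [history_succ, record, pair, info, ih (by omega), Function.update_of_ne hne]

variable [Finite S] [Finite A] [MeasurableSingletonClass S] [MeasurableSingletonClass A]

lemma measurable_info (ρ : SamplingRule W S A) (n : ℕ) : Measurable (ρ.info n) :=
  measurable_fst.prodMk (ρ.measurable_history n)

lemma measurable_pair (ρ : SamplingRule W S A) (n : ℕ) : Measurable (ρ.pair n) :=
  (ρ.measurable_query n).comp (ρ.measurable_info n)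

lemma measurable_record (ρ : SamplingRule W S A) (n : ℕ) : Measurable (ρ.record n) := by
  have h := (measurable_pi_apply (Fin.last n)).comp (ρ.measurable_history (n + 1))
  simpa [Function.comp_def, history_succ] using h

lemma measurableSet_pair_eq (ρ : SamplingRule W S A) (n : ℕ) (z : S × A) :
    MeasurableSet[ρ.filtration n] {x | ρ.pair n x = z} :=
  ⟨_, ρ.measurable_query n (measurableSet_singleton z), rfl⟩

end SamplingRule

namespace GenAlgorithm

variable {W S A : Type*} [MeasurableSpace W] [Fintype S] [MeasurableSpace S]
  [MeasurableSingletonClass S] [Fintype A] [MeasurableSpace A] [MeasurableSingletonClass A]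
  {γ : Set.Ico (0 : ℝ) 1} {p₀ : ProbabilityMeasure S}
  (alg : GenAlgorithm W S A) (φ ψ : MDP S A γ p₀)

lemma law_eq : alg.law φ = (alg.seedLaw : Measure W).prod
    (Measure.infinitePi fun _ : ℕ => Measure.pi φ.obs) :=
  rfl

instance : IsProbabilityMeasure (alg.law φ) := by
  rw [law_eq]; infer_instance

/-- The information at time `n` is independent of the answers prepared for round `n`: given that
information, the record of round `n` consists of the queried pair `z` and of a sample of
`φ.obs z`. -/
lemma lintegral_info_record (n : ℕ)
    {F : (W × (Fin n → Round S A)) × Round S A → ℝ≥0∞} (hF : Measurable F) :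
    ∫⁻ x, F (alg.rule.info n x, alg.rule.record n x) ∂(alg.law φ) =
      ∫⁻ x, ∫⁻ y, F (alg.rule.info n x, (alg.rule.pair n x, y)) ∂(φ.obs (alg.rule.pair n x))
        ∂(alg.law φ) := by
  have hleft : Measurable fun x => F (alg.rule.info n x, alg.rule.record n x) :=
    hF.comp ((alg.rule.measurable_info n).prodMk (alg.rule.measurable_record n))
  have hright : Measurable fun x =>
      ∫⁻ y, F (alg.rule.info n x, (alg.rule.pair n x, y)) ∂(φ.obs (alg.rule.pair n x)) :=
    (φ.measurable_lintegral_obs hF).comp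
      ((alg.rule.measurable_info n).prodMk (alg.rule.measurable_pair n))
  rw [law_eq, lintegral_prod _ hleft.aemeasurable, lintegral_prod _ hright.aemeasurable]
  refine lintegral_congr fun w => ?_
  have hupd : Measurable fun p : (ℕ → S × A → S × unitInterval) × (S × A → S × unitInterval) =>
      Function.update p.1 n p.2 := by fun_prop
  conv_lhs => rw [← infinitePi_map_update (Measure.pi φ.obs) n]
  have hsec : Measurable fun y => F (alg.rule.info n (w, y), alg.rule.record n (w, y)) :=
    hleft.comp measurable_prodMk_left
  rw [lintegral_map hsec hupd, lintegral_prod (fun p => F (alg.rule.info n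
    (w, Function.update p.1 n p.2), alg.rule.record n (w, Function.update p.1 n p.2)))
    (hsec.comp hupd).aemeasurable]
  refine lintegral_congr fun y => ?_
  set z := alg.rule.pair n (w, y) with hz
  have hinfo v : alg.rule.info n (w, Function.update y n v) = alg.rule.info n (w, y) := by
    simp only [SamplingRule.info, alg.rule.history_update le_rfl]
  have hrec v : alg.rule.record n (w, Function.update y n v) = (z, v z) := by
    simp only [SamplingRule.record, SamplingRule.pair, hinfo, Function.update_self, hz]
  simp_rw [hinfo, hrec]
  exact (measurePreserving_eval φ.obs z).lintegral_comp
    (f := fun y' => F (alg.rule.info n (w, y), (z, y'))) (hF.comp (by fun_prop))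

variable {φ ψ} in
/-- Change of measure at time `n`: the inverse likelihood ratio of the first `n` records turns the
law under `φ` of the information at time `n` into at most its law under `ψ`. -/
lemma lintegral_prod_inv_likelihoodRatio_mul_le (h : φ.AbsCont ψ) (n : ℕ)
    {G : W × (Fin n → Round S A) → ℝ≥0∞} (hG : Measurable G) :
    ∫⁻ x, (∏ i, (φ.likelihoodRatio ψ (alg.rule.history n x i))⁻¹) * G (alg.rule.info n x)
        ∂(alg.law φ) ≤ ∫⁻ x, G (alg.rule.info n x) ∂(alg.law ψ) := by
  have hlr := (φ.measurable_likelihoodRatio ψ).inv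
  induction n with
  | zero =>
    have hzero (χ : MDP S A γ p₀) : ∫⁻ x, G (alg.rule.info 0 x) ∂(alg.law χ) =
        ∫⁻ w, G (w, Fin.elim0) ∂(alg.seedLaw : Measure W) := by
      rw [law_eq, lintegral_prod (fun x => G (alg.rule.info 0 x))
        (hG.comp (alg.rule.measurable_info 0)).aemeasurable]
      simp [SamplingRule.info, SamplingRule.history]
    simp [hzero]
  | succ n ih =>
    -- the test function at time `n + 1` as a function of the information at time `n` and of the
    -- record of round `n`
    set F : (W × (Fin n → Round S A)) × Round S A → ℝ≥0∞ := fun q =>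
      G (q.1.1, Fin.snoc (α := fun _ => Round S A) q.1.2 q.2) with hFdef
    have hF : Measurable F := by
      refine hG.comp (measurable_fst.fst.prodMk (measurable_pi_lambda _ fun i => ?_))
      refine Fin.lastCases ?_ (fun j => ?_) i
      · simpa using measurable_snd
      · simpa [Function.comp_def] using
          (measurable_pi_apply j).comp (measurable_snd.comp measurable_fst)
    set M : (Fin n → Round S A) → ℝ≥0∞ := fun t => ∏ i, (φ.likelihoodRatio ψ (t i))⁻¹ with hMdef
    have hM : Measurable M := Finset.measurable_fun_prod _ fun i _ =>
      hlr.comp (measurable_pi_apply i)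
    set H : W × (Fin n → Round S A) → ℝ≥0∞ := fun q =>
      ∫⁻ y, F (q, (alg.rule.query n q, y)) ∂(ψ.obs (alg.rule.query n q)) with hHdef
    have hH : Measurable H := (ψ.measurable_lintegral_obs hF).comp
      (measurable_id.prodMk (alg.rule.measurable_query n))
    calc ∫⁻ x, (∏ i, (φ.likelihoodRatio ψ (alg.rule.history (n + 1) x i))⁻¹) *
            G (alg.rule.info (n + 1) x) ∂(alg.law φ)
        = ∫⁻ x, (fun q : (W × (Fin n → Round S A)) × Round S A =>
            M q.1.2 * ((φ.likelihoodRatio ψ q.2)⁻¹ * F q))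
              (alg.rule.info n x, alg.rule.record n x) ∂(alg.law φ) := by
          refine lintegral_congr fun x => ?_
          simp only [hMdef, hFdef, SamplingRule.info, Fin.prod_univ_castSucc,
            SamplingRule.history_succ, Fin.snoc_castSucc, Fin.snoc_last, mul_assoc]
      _ = ∫⁻ x, ∫⁻ y, M (alg.rule.history n x) *
            ((φ.likelihoodRatio ψ (alg.rule.pair n x, y))⁻¹ *
              F (alg.rule.info n x, (alg.rule.pair n x, y))) ∂(φ.obs (alg.rule.pair n x))
            ∂(alg.law φ) :=
          alg.lintegral_info_record φ n ((hM.comp measurable_fst.snd).mul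
            ((hlr.comp measurable_snd).mul hF))
      _ ≤ ∫⁻ x, M (alg.rule.history n x) * H (alg.rule.info n x) ∂(alg.law φ) := by
          refine lintegral_mono fun x => ?_
          have hFx : Measurable fun y => F (alg.rule.info n x, (alg.rule.pair n x, y)) :=
            hF.comp (by fun_prop)
          have hlrx : Measurable fun y => (φ.likelihoodRatio ψ (alg.rule.pair n x, y))⁻¹ :=
            hlr.comp measurable_prodMk_left
          rw [lintegral_const_mul (f := fun y => (φ.likelihoodRatio ψ (alg.rule.pair n x, y))⁻¹ *
            F (alg.rule.info n x, (alg.rule.pair n x, y))) _ (hlrx.mul hFx)]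
          exact mul_le_mul_right (MDP.lintegral_inv_likelihoodRatio_mul_le h _ hFx) _
      _ ≤ ∫⁻ x, H (alg.rule.info n x) ∂(alg.law ψ) := ih hH
      _ = ∫⁻ x, G (alg.rule.info (n + 1) x) ∂(alg.law ψ) :=
          (alg.lintegral_info_record ψ n hF).symm

variable {φ ψ} in
lemma setLIntegral_prod_inv_likelihoodRatio_le (h : φ.AbsCont ψ) (n : ℕ)
    {D : Set (SampleSpace W S A)} (hD : MeasurableSet[alg.rule.filtration n] D) :
    ∫⁻ x in D, ∏ i, (φ.likelihoodRatio ψ (alg.rule.history n x i))⁻¹ ∂(alg.law φ) ≤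
      alg.law ψ D := by
  have hD' := alg.rule.filtration.le n D hD
  obtain ⟨B, hB, rfl⟩ : ∃ B, MeasurableSet B ∧ alg.rule.info n ⁻¹' B = D := hD
  have := alg.lintegral_prod_inv_likelihoodRatio_mul_le h n (measurable_one.indicator hB)
  rw [← lintegral_indicator hD', ← lintegral_indicator_one hD']
  refine le_trans (lintegral_mono fun x => ?_) this
  by_cases hx : alg.rule.info n x ∈ B
  · rw [Set.indicator_of_mem (by exact hx), Set.indicator_of_mem hx, Pi.one_apply, mul_one]
  · rw [Set.indicator_of_notMem (by exact hx)]; exact zero_le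

/-- On an event decided before round `n`, the record of round `n` averages a function over the laws
of the observations of the queried pairs. -/
lemma setLIntegral_record (n : ℕ) {D : Set (SampleSpace W S A)}
    (hD : MeasurableSet[alg.rule.filtration n] D) {g : Round S A → ℝ≥0∞} (hg : Measurable g) :
    ∫⁻ x in D, g (alg.rule.record n x) ∂(alg.law φ) =
      ∑ z, alg.law φ (D ∩ {x | alg.rule.pair n x = z}) * ∫⁻ y, g (z, y) ∂(φ.obs z) := by
  classical
  have hD' := alg.rule.filtration.le n D hD
  have hz (z : S × A) : MeasurableSet {x | alg.rule.pair n x = z} :=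
    alg.rule.measurable_pair n (measurableSet_singleton z)
  obtain ⟨B, hB, rfl⟩ : ∃ B, MeasurableSet B ∧ alg.rule.info n ⁻¹' B = D := hD
  have hF : Measurable fun q : (W × (Fin n → Round S A)) × Round S A =>
      B.indicator 1 q.1 * g q.2 :=
    ((measurable_one.indicator hB).comp measurable_fst).mul (hg.comp measurable_snd)
  have hstep := alg.lintegral_info_record φ n hF
  rw [← lintegral_indicator hD']
  calc _ = ∫⁻ x, B.indicator 1 (alg.rule.info n x) * g (alg.rule.record n x) ∂(alg.law φ) := by
        refine lintegral_congr fun x => ?_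
        by_cases hx : alg.rule.info n x ∈ B
        · rw [Set.indicator_of_mem (by exact hx), Set.indicator_of_mem hx, Pi.one_apply, one_mul]
        · rw [Set.indicator_of_notMem (by exact hx), Set.indicator_of_notMem hx, zero_mul]
    _ = _ := hstep
    _ = ∫⁻ x, ∑ z, (alg.rule.info n ⁻¹' B ∩ {x | alg.rule.pair n x = z}).indicator
          (fun _ => ∫⁻ y, g (z, y) ∂(φ.obs z)) x ∂(alg.law φ) := by
        refine lintegral_congr fun x => ?_
        rw [Finset.sum_eq_single (alg.rule.pair n x)]
        · by_cases hx : alg.rule.info n x ∈ B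
          · have hmem : x ∈ alg.rule.info n ⁻¹' B ∩ {x' | alg.rule.pair n x' = alg.rule.pair n x} :=
              ⟨hx, rfl⟩
            rw [Set.indicator_of_mem hmem]
            simp [Set.indicator_of_mem hx]
          · rw [Set.indicator_of_notMem fun h => hx h.1]
            simp [Set.indicator_of_notMem hx]
        · exact fun z _ hne => Set.indicator_of_notMem (fun h => hne h.2.symm) _
        · simp
    _ = _ := by
        rw [lintegral_finsetSum _ fun z _ => measurable_const.indicator (hD'.inter (hz z))]
        refine Finset.sum_congr rfl fun z _ => ?_
        rw [lintegral_indicator_const (hD'.inter (hz z)), mul_comm]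

lemma ae_record {g : Round S A → Prop} (hg : MeasurableSet {p | g p})
    (h : ∀ z, ∀ᵐ y ∂(φ.obs z), g (z, y)) (n : ℕ) :
    ∀ᵐ x ∂(alg.law φ), g (alg.rule.record n x) := by
  have h1 := alg.setLIntegral_record φ n (D := Set.univ) MeasurableSet.univ
    (measurable_one.indicator hg.compl)
  rw [Finset.sum_eq_zero, Measure.restrict_univ, lintegral_eq_zero_iff
    (f := fun x => {p | g p}ᶜ.indicator 1 (alg.rule.record n x))
    ((measurable_one.indicator hg.compl).comp (alg.rule.measurable_record n))] at h1
  · filter_upwards [h1] with x hx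
    by_contra hne
    have : alg.rule.record n x ∈ {p | g p}ᶜ := hne
    simp [Set.indicator_of_mem this] at hx
  · intro z _
    have : ∫⁻ y, {p | g p}ᶜ.indicator 1 (z, y) ∂(φ.obs z) = 0 := by
      rw [lintegral_eq_zero_iff (f := fun y => {p | g p}ᶜ.indicator 1 (z, y))
        ((measurable_one.indicator hg.compl).comp measurable_prodMk_left)]
      filter_upwards [h z] with y hy
      simp [hy]
    rw [this, mul_zero]

/-- The version of `setLIntegral_record` for Bochner integrals. -/
lemma setIntegral_record (n : ℕ) {D : Set (SampleSpace W S A)}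
    (hD : MeasurableSet[alg.rule.filtration n] D) {g : Round S A → ℝ} (hg : Measurable g)
    (hint : IntegrableOn (fun x => g (alg.rule.record n x)) D (alg.law φ)) :
    ∫ x in D, g (alg.rule.record n x) ∂(alg.law φ) =
      ∑ z, (alg.law φ).real (D ∩ {x | alg.rule.pair n x = z}) * ∫ y, g (z, y) ∂(φ.obs z) := by
  classical
  have hDz (z : S × A) : MeasurableSet[alg.rule.filtration n]
      (D ∩ {x | alg.rule.pair n x = z}) := hD.inter (alg.rule.measurableSet_pair_eq n z)
  have hDz' (z : S × A) := alg.rule.filtration.le n _ (hDz z)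
  have hev (z : S × A) : Measurable fun x : SampleSpace W S A => x.2 n z := by fun_prop
  have hU : D = ⋃ z ∈ (Finset.univ : Finset (S × A)), D ∩ {x | alg.rule.pair n x = z} := by
    ext x; simp
  conv_lhs => rw [hU]
  rw [integral_biUnion_finset _ (fun z _ => hDz' z) ?_ fun z _ => hint.mono_set
    Set.inter_subset_left]
  · refine Finset.sum_congr rfl fun z _ => ?_
    -- on the event that `z` is queried, the answer is a sample of `φ.obs z`
    have hmap : ((alg.law φ).restrict (D ∩ {x | alg.rule.pair n x = z})).map (fun x => x.2 n z) =
        alg.law φ (D ∩ {x | alg.rule.pair n x = z}) • φ.obs z := by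
      ext T hT
      have h1 := alg.setLIntegral_record φ n (hDz z) (g := fun p => T.indicator 1 p.2)
        ((measurable_one.indicator hT).comp measurable_snd)
      rw [Finset.sum_eq_single z] at h1
      · rw [Set.inter_assoc, Set.inter_self, lintegral_indicator_one hT] at h1
        rw [Measure.smul_apply, smul_eq_mul, ← h1, ← lintegral_indicator_one hT,
          lintegral_map (measurable_one.indicator hT) (hev z)]
        refine setLIntegral_congr_fun (hDz' z) fun x hx => ?_
        have hx2 : alg.rule.pair n x = z := hx.2
        simp [SamplingRule.record, hx2]
      · intro z' _ hne
        have : D ∩ {x | alg.rule.pair n x = z} ∩ {x | alg.rule.pair n x = z'} = ∅ := by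
          ext x
          simp only [Set.mem_inter_iff, Set.mem_ofPred_eq, Set.mem_empty_iff_false, iff_false]
          rintro ⟨⟨_, h⟩, h'⟩
          exact hne (h'.symm.trans h)
        rw [this, measure_empty, zero_mul]
      · simp
    calc ∫ x in D ∩ {x | alg.rule.pair n x = z}, g (alg.rule.record n x) ∂(alg.law φ)
        = ∫ x in D ∩ {x | alg.rule.pair n x = z}, g (z, x.2 n z) ∂(alg.law φ) := by
          refine setIntegral_congr_fun (hDz' z) fun x hx => ?_
          have hx2 : alg.rule.pair n x = z := hx.2
          simp [SamplingRule.record, hx2]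
      _ = ∫ y, g (z, y) ∂((alg.law φ).restrict (D ∩ {x | alg.rule.pair n x = z})).map
            (fun x => x.2 n z) :=
          (integral_map (hev z).aemeasurable
            (hg.comp measurable_prodMk_left).aestronglyMeasurable).symm
      _ = _ := by rw [hmap, integral_smul_measure]; rfl
  · intro z _ z' _ hne
    refine Set.disjoint_left.2 fun x hx hx' => hne ?_
    exact (show alg.rule.pair n x = z from hx.2).symm.trans hx'.2

end GenAlgorithm

/-! ### From the mean log-likelihood ratio to the Bernoulli divergence -/

/-- Data processing for the event `s`. With `c = log ((1-δ)/δ)`, the inequality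
`1 + u ≤ exp u` at `u = c - L` on `s` and at `u = -c - L` off `s` gives, after integration, a bound
on `∫ L` that is monotone in the two probabilities. -/
lemma klBernoulli_le_integral {Ω : Type*} [MeasurableSpace Ω] {μ : Measure Ω}
    [IsProbabilityMeasure μ] {δ q : ℝ} (hδ : 0 < δ) (hδ' : δ ≤ 1 / 2) {L : Ω → ℝ}
    (hL : Integrable L μ) {s : Set Ω} (hs : MeasurableSet s) (hμs : 1 - δ ≤ μ.real s)
    (hq0 : 0 ≤ q) (hq : q ≤ δ)
    (h1 : ∫⁻ x in s, ENNReal.ofReal (Real.exp (-L x)) ∂μ ≤ ENNReal.ofReal q)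
    (h2 : ∫⁻ x in sᶜ, ENNReal.ofReal (Real.exp (-L x)) ∂μ ≤ ENNReal.ofReal (1 - q)) :
    klBernoulli δ (1 - δ) ≤ ∫ x, L x ∂μ := by
  have h1δ : 0 < 1 - δ := by linarith
  set c : ℝ := Real.log ((1 - δ) / δ) with hc
  have hc0 : 0 ≤ c := Real.log_nonneg (by rw [le_div_iff₀ hδ]; linarith)
  have hkl : klBernoulli δ (1 - δ) = (1 - 2 * δ) * c := by
    rw [klBernoulli, hc, Real.log_div hδ.ne' h1δ.ne', Real.log_div h1δ.ne' hδ.ne',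
      Real.log_div h1δ.ne' (by simpa using hδ.ne')]
    ring_nf
  have key (t : Set Ω) (b r : ℝ) (hr : 0 ≤ r)
      (ht : ∫⁻ x in t, ENNReal.ofReal (Real.exp (-L x)) ∂μ ≤ ENNReal.ofReal r) :
      μ.real t * (1 + b) - ∫ x in t, L x ∂μ ≤ Real.exp b * r := by
    have hmeas : AEStronglyMeasurable (fun x => Real.exp (-L x)) (μ.restrict t) :=
      Real.continuous_exp.comp_aestronglyMeasurable hL.1.neg.restrict
    have hnn : 0 ≤ᵐ[μ.restrict t] fun x => Real.exp (-L x) :=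
      Filter.Eventually.of_forall fun x => (Real.exp_pos _).le
    have hint : Integrable (fun x => Real.exp (-L x)) (μ.restrict t) := by
      refine ⟨hmeas, ?_⟩
      rw [hasFiniteIntegral_iff_ofReal hnn]
      exact ht.trans_lt ENNReal.ofReal_lt_top
    have hexp : ∫ x in t, Real.exp (-L x) ∂μ ≤ r := by
      rw [integral_eq_lintegral_of_nonneg_ae hnn hmeas]
      exact ENNReal.toReal_le_of_le_ofReal hr ht
    calc μ.real t * (1 + b) - ∫ x in t, L x ∂μ = ∫ x in t, ((1 + b) - L x) ∂μ := by
          rw [integral_sub (integrable_const _) hL.restrict, setIntegral_const, smul_eq_mul]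
      _ ≤ ∫ x in t, Real.exp b * Real.exp (-L x) ∂μ := by
          refine integral_mono ((integrable_const _).sub hL.restrict) (hint.const_mul _) fun x => ?_
          change 1 + b - L x ≤ Real.exp b * Real.exp (-L x)
          rw [← Real.exp_add]
          linarith [Real.add_one_le_exp (b + -L x)]
      _ ≤ Real.exp b * r := by
          rw [integral_const_mul]
          exact mul_le_mul_of_nonneg_left hexp (Real.exp_pos _).le
  have k1 := key s c q hq0 h1
  have k2 := key sᶜ (-c) (1 - q) (by linarith) h2
  rw [probReal_compl_eq_one_sub hs] at k2
  rw [Real.exp_neg, hc, Real.exp_log (div_pos h1δ hδ), ← hc, inv_div] at k2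
  rw [hc, Real.exp_log (div_pos h1δ hδ), ← hc] at k1
  have hsum := integral_add_compl hs hL
  -- the left-hand side is increasing in `q` and equals `1` at `q = δ`
  have hsub : (1 - δ) / δ * q + δ / (1 - δ) * (1 - q) ≤ 1 := by
    have hle : δ / (1 - δ) ≤ (1 - δ) / δ := by
      rw [div_le_div_iff₀ h1δ hδ]; nlinarith
    have heq : (1 - δ) / δ * δ + δ / (1 - δ) * (1 - δ) = 1 := by
      field_simp; ring
    nlinarith [mul_nonneg (sub_nonneg.2 hle) (sub_nonneg.2 hq)]
  rw [hkl]
  nlinarith [mul_nonneg hc0 (sub_nonneg.2 hμs)]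

/-! ### The likelihood ratio at the stopping time -/

lemma ENat.tsum_indicator_lt (t : ℕ∞) :
    ∑' n : ℕ, {m : ℕ∞ | m < t}.indicator (1 : ℕ∞ → ℝ≥0∞) n = (t : ℝ≥0∞) := by
  induction t using ENat.recTopCoe with
  | top =>
    simp
  | coe N =>
    rw [tsum_eq_sum (s := Finset.range N) fun n hn => by simpa using hn]
    have h1 (n) (hn : n ∈ Finset.range N) :
        {m : ℕ∞ | m < (N : ℕ∞)}.indicator (1 : ℕ∞ → ℝ≥0∞) n = 1 := by
      have hn' : (n : ℕ∞) ∈ {m : ℕ∞ | m < (N : ℕ∞)} := by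
        rw [Set.mem_ofPred_eq]
        exact Nat.cast_lt.2 (Finset.mem_range.1 hn)
      rw [Set.indicator_of_mem hn', Pi.one_apply]
    rw [Finset.sum_congr rfl h1]
    simp

namespace GenAlgorithm

variable {W S A : Type*} [MeasurableSpace W] [Fintype S] [MeasurableSpace S]
  [MeasurableSingletonClass S] [Fintype A] [MeasurableSpace A] [MeasurableSingletonClass A]
  {γ : Set.Ico (0 : ℝ) 1} {p₀ : ProbabilityMeasure S}
  (alg : GenAlgorithm W S A) (φ ψ : MDP S A γ p₀)

/-- The event that round `n` takes place. -/
def active (n : ℕ) : Set (SampleSpace W S A) := {x | (n : ℕ∞) < alg.τ x}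

lemma measurableSet_active (n : ℕ) : MeasurableSet[alg.rule.filtration n] (alg.active n) :=
  alg.isStoppingTime.measurableSet_gt n

lemma measurableSet_active' (n : ℕ) : MeasurableSet (alg.active n) :=
  alg.rule.filtration.le n _ (alg.measurableSet_active n)

lemma measurableSet_stop_eq (n : ℕ) :
    MeasurableSet[alg.rule.filtration n] {x | alg.τ x = (n : ℕ∞)} :=
  alg.isStoppingTime.measurableSet_eq n

lemma measurableSet_stop_ne_top : MeasurableSet {x | alg.τ x ≠ ⊤} := by
  have h : {x | alg.τ x ≠ ⊤} = ⋃ n : ℕ, {x | alg.τ x = (n : ℕ∞)} := by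
    ext x
    simp only [Set.mem_ofPred_eq, Set.mem_iUnion, ENat.ne_top_iff_exists, eq_comm]
  rw [h]
  exact MeasurableSet.iUnion fun n => alg.rule.filtration.le n _ (alg.measurableSet_stop_eq n)

/-- The expected number of queries of the pair `z` before stopping. -/
noncomputable def visits (z : S × A) : ℝ≥0∞ :=
  ∑' n : ℕ, alg.law φ (alg.active n ∩ {x | alg.rule.pair n x = z})

lemma sum_visits : ∑ z, alg.visits φ z = alg.sampleComplexity φ := by
  have hn (n : ℕ) : ∑ z, alg.law φ (alg.active n ∩ {x | alg.rule.pair n x = z}) =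
      ∫⁻ x, (alg.active n).indicator 1 x ∂(alg.law φ) := by
    have h := alg.setLIntegral_record φ n (alg.measurableSet_active n) (g := fun _ => 1)
      measurable_const
    simp only [lintegral_const, measure_univ, mul_one, one_mul, Measure.restrict_apply_univ] at h
    rw [lintegral_indicator_one (alg.measurableSet_active' n), h]
  simp only [visits]
  rw [← Summable.tsum_finsetSum fun _ _ => ENNReal.summable]
  simp_rw [hn]
  rw [← lintegral_tsum fun n =>
    (measurable_one.indicator (alg.measurableSet_active' n)).aemeasurable, sampleComplexity]
  exact lintegral_congr fun x => ENat.tsum_indicator_lt (alg.τ x)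

/-- The log-likelihood ratio of `φ` against `ψ` of the records up to the stopping time. -/
noncomputable def stoppedLog (x : SampleSpace W S A) : ℝ :=
  ∑' n : ℕ, (alg.active n).indicator
    (fun x => Real.log (φ.likelihoodRatio ψ (alg.rule.record n x)).toReal) x

lemma hasSum_stoppedLog_of_stop_eq {x : SampleSpace W S A} {N : ℕ} (hN : alg.τ x = N) :
    HasSum (fun n => (alg.active n).indicator
      (fun x => Real.log (φ.likelihoodRatio ψ (alg.rule.record n x)).toReal) x)
      (∑ n ∈ Finset.range N, Real.log (φ.likelihoodRatio ψ (alg.rule.record n x)).toReal) := by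
  have h (n : ℕ) : x ∈ alg.active n ↔ n < N := by simp [active, hN]
  rw [Finset.sum_congr rfl fun n hn => (Set.indicator_of_mem
    ((h n).2 (Finset.mem_range.1 hn)) (f := fun x => Real.log
      (φ.likelihoodRatio ψ (alg.rule.record n x)).toReal)).symm]
  refine hasSum_sum_of_ne_finset_zero fun n hn => Set.indicator_of_notMem (fun hx => hn ?_) _
  exact Finset.mem_range.2 ((h n).1 hx)

variable {φ ψ}

lemma exp_neg_stoppedLog {x : SampleSpace W S A} {N : ℕ} (hN : alg.τ x = N)
    (hpos : ∀ n, 0 < (φ.likelihoodRatio ψ (alg.rule.record n x)).toReal) :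
    ENNReal.ofReal (Real.exp (-alg.stoppedLog φ ψ x)) =
      ∏ i, (φ.likelihoodRatio ψ (alg.rule.history N x i))⁻¹ := by
  simp_rw [alg.rule.history_apply]
  rw [stoppedLog, (alg.hasSum_stoppedLog_of_stop_eq φ ψ hN).tsum_eq, ← Finset.sum_neg_distrib,
    Real.exp_sum, ENNReal.ofReal_prod_of_nonneg fun _ _ => (Real.exp_pos _).le,
    Fin.prod_univ_eq_prod_range (fun n => (φ.likelihoodRatio ψ (alg.rule.record n x))⁻¹) N]
  refine Finset.prod_congr rfl fun n _ => ?_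
  rw [Real.exp_neg, Real.exp_log (hpos n), ENNReal.ofReal_inv_of_pos (hpos n),
    ENNReal.ofReal_toReal]
  exact (ENNReal.toReal_pos_iff.1 (hpos n)).2.ne

/-- Change of measure at the stopping time, obtained from the one at fixed times by splitting along
the value of `τ`. -/
lemma setLIntegral_exp_neg_stoppedLog_le (h : φ.AbsCont ψ)
    (hτtop : ∀ᵐ x ∂(alg.law φ), alg.τ x ≠ ⊤) {s : Set (SampleSpace W S A)}
    (hs : MeasurableSet[alg.isStoppingTime.measurableSpace] s) :
    ∫⁻ x in s, ENNReal.ofReal (Real.exp (-alg.stoppedLog φ ψ x)) ∂(alg.law φ) ≤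
      alg.law ψ ({x | alg.τ x ≠ ⊤} ∩ s) := by
  set D : ℕ → Set (SampleSpace W S A) := fun n => {x | alg.τ x = (n : ℕ∞)} ∩ s with hDdef
  have hD (n : ℕ) : MeasurableSet[alg.rule.filtration n] (D n) := by
    have heq : D n = (s ∩ {x | alg.τ x ≤ (n : ℕ∞)}) ∩ {x | alg.τ x = (n : ℕ∞)} := by
      ext x
      simp only [hDdef, Set.mem_inter_iff, Set.mem_ofPred_eq]
      constructor
      · rintro ⟨h1, h2⟩; exact ⟨⟨h2, h1.le⟩, h1⟩
      · rintro ⟨⟨h1, _⟩, h2⟩; exact ⟨h2, h1⟩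
    rw [heq]
    exact (hs.2 n).inter (alg.measurableSet_stop_eq n)
  have hD' (n : ℕ) : MeasurableSet (D n) := alg.rule.filtration.le n _ (hD n)
  have hdisj : Pairwise (Function.onFun Disjoint D) := fun m n hmn =>
    Set.disjoint_left.2 fun x hx hx' => hmn (by exact_mod_cast hx.1.symm.trans hx'.1)
  have hU : ⋃ n, D n = {x | alg.τ x ≠ ⊤} ∩ s := by
    ext x
    simp only [hDdef, Set.mem_iUnion, Set.mem_inter_iff, Set.mem_ofPred_eq, exists_and_right,
      ENat.ne_top_iff_exists, eq_comm]
  have hpos : ∀ᵐ x ∂(alg.law φ), ∀ n,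
      0 < (φ.likelihoodRatio ψ (alg.rule.record n x)).toReal :=
    ae_all_iff.2 fun n => alg.ae_record φ
      (measurableSet_lt measurable_const (φ.measurable_likelihoodRatio ψ).ennreal_toReal)
      (fun z => MDP.ae_likelihoodRatio_pos h z) n
  have hae : s =ᵐ[alg.law φ] ⋃ n, D n := by
    rw [hU]
    filter_upwards [hτtop] with x hx
    exact propext ⟨fun h => ⟨hx, h⟩, fun h => h.2⟩
  rw [setLIntegral_congr hae, ← hU, lintegral_iUnion hD' hdisj, measure_iUnion hdisj hD']
  refine ENNReal.tsum_le_tsum fun n => ?_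
  refine le_trans (le_of_eq ?_) (alg.setLIntegral_prod_inv_likelihoodRatio_le h n (hD n))
  refine setLIntegral_congr_fun_ae (hD' n) ?_
  filter_upwards [hpos] with x hx hxD
  exact alg.exp_neg_stoppedLog hxD.1 hx

/-- Wald's identity for the log-likelihood ratio. A pair with infinite divergence is harmless if it
is almost surely never queried before stopping. -/
lemma integral_stoppedLog (h : φ.AbsCont ψ) (hτtop : ∀ᵐ x ∂(alg.law φ), alg.τ x ≠ ⊤)
    (hτ : alg.sampleComplexity φ ≠ ∞) (hfin : ∀ z, alg.visits φ z * φ.KL ψ z ≠ ∞) :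
    Integrable (alg.stoppedLog φ ψ) (alg.law φ) ∧
      ENNReal.ofReal (∫ x, alg.stoppedLog φ ψ x ∂(alg.law φ)) =
        ∑ z, alg.visits φ z * φ.KL ψ z := by
  set g : Round S A → ℝ := fun p => Real.log (φ.likelihoodRatio ψ p).toReal with hgdef
  have hg : Measurable g := (φ.measurable_likelihoodRatio ψ).ennreal_toReal.log
  set f : ℕ → SampleSpace W S A → ℝ := fun n =>
    (alg.active n).indicator fun x => g (alg.rule.record n x) with hfdef
  have hf (n : ℕ) : Measurable (f n) :=
    (hg.comp (alg.rule.measurable_record n)).indicator (alg.measurableSet_active' n)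
  have hvis (z : S × A) : alg.visits φ z ≠ ∞ := by
    refine ne_top_of_le_ne_top hτ ?_
    rw [← alg.sum_visits φ]
    exact Finset.single_le_sum (fun _ _ => zero_le) (Finset.mem_univ z)
  have hnorm : ∑' n, ∫⁻ x, ‖f n x‖ₑ ∂(alg.law φ) ≠ ∞ := by
    have hn (n : ℕ) : ∫⁻ x, ‖f n x‖ₑ ∂(alg.law φ) =
        ∑ z, alg.law φ (alg.active n ∩ {x | alg.rule.pair n x = z}) *
          ∫⁻ y, ‖g (z, y)‖ₑ ∂(φ.obs z) := by
      rw [← alg.setLIntegral_record φ n (alg.measurableSet_active n) hg.enorm,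
        ← lintegral_indicator (alg.measurableSet_active' n)]
      exact lintegral_congr fun x => by simp only [hfdef, enorm_indicator_eq_indicator_enorm]
    simp_rw [hn]
    rw [Summable.tsum_finsetSum fun _ _ => ENNReal.summable]
    simp_rw [ENNReal.tsum_mul_right]
    refine ENNReal.sum_ne_top.2 fun z _ => ?_
    change alg.visits φ z * _ ≠ ∞
    by_cases h0 : alg.visits φ z = 0
    · simp [h0]
    · have hKL : φ.KL ψ z ≠ ∞ := fun hz => hfin z (by rw [hz, ENNReal.mul_top h0])
      exact ENNReal.mul_ne_top (hvis z) (MDP.integrable_log_likelihoodRatio hKL).2.ne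
  have hfi (n : ℕ) : Integrable (f n) (alg.law φ) :=
    ⟨(hf n).aestronglyMeasurable, (ne_top_of_le_ne_top hnorm (ENNReal.le_tsum n)).lt_top⟩
  have hint : Integrable (alg.stoppedLog φ ψ) (alg.law φ) := by
    have hlim : ∀ᵐ x ∂(alg.law φ), Filter.Tendsto (fun N => ∑ n ∈ Finset.range N, f n x)
        Filter.atTop (nhds (alg.stoppedLog φ ψ x)) := by
      filter_upwards [hτtop] with x hx
      obtain ⟨N, hN⟩ := ENat.ne_top_iff_exists.1 hx
      exact (alg.hasSum_stoppedLog_of_stop_eq φ ψ hN.symm).summable.hasSum.tendsto_sum_nat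
    refine ⟨aestronglyMeasurable_of_tendsto_ae _ (fun N =>
      (Finset.measurable_fun_sum _ fun n _ => hf n).aestronglyMeasurable) hlim, ?_⟩
    refine lt_of_le_of_lt ?_ hnorm.lt_top
    rw [← lintegral_tsum fun n => (hf n).enorm.aemeasurable]
    exact lintegral_mono fun x => enorm_tsum_le_tsum_enorm
  refine ⟨hint, ?_⟩
  have hn (n : ℕ) : ∫ x, f n x ∂(alg.law φ) =
      ∑ z, (alg.law φ).real (alg.active n ∩ {x | alg.rule.pair n x = z}) *
        (φ.KL ψ z).toReal := by
    simp only [hfdef]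
    rw [integral_indicator (alg.measurableSet_active' n), alg.setIntegral_record φ n
      (alg.measurableSet_active n) hg
      ((integrable_indicator_iff (alg.measurableSet_active' n)).1 (hfi n))]
    exact Finset.sum_congr rfl fun z _ => by rw [MDP.integral_log_likelihoodRatio h z]
  have hsum (z : S × A) : HasSum
      (fun n => (alg.law φ).real (alg.active n ∩ {x | alg.rule.pair n x = z}))
      (alg.visits φ z).toReal := by
    rw [visits, ENNReal.tsum_toReal_eq fun n => measure_ne_top _ _]
    exact ENNReal.hasSum_toReal (hvis z)
  have hE : ∫ x, alg.stoppedLog φ ψ x ∂(alg.law φ) =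
      ∑ z, (alg.visits φ z * φ.KL ψ z).toReal := by
    change ∫ x, ∑' n, f n x ∂(alg.law φ) = _
    rw [integral_tsum (fun n => (hf n).aestronglyMeasurable) hnorm]
    simp_rw [hn, ENNReal.toReal_mul]
    exact (hasSum_sum fun z _ => (hsum z).mul_right _).tsum_eq
  rw [hE, ENNReal.ofReal_sum_of_nonneg fun _ _ => ENNReal.toReal_nonneg]
  exact Finset.sum_congr rfl fun z _ => ENNReal.ofReal_toReal (hfin z)

/-! ### The lower bound -/

/-- The event that the recommendation is `ε`-optimal for `φ` is likely under `φ` and unlikely under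
a confusing `ψ`. By the change of measure at the stopping time, the mean log-likelihood ratio is
then at least `kl(δ, 1-δ)`, and Wald's identity computes this mean. -/
lemma klBernoulli_le_sum_visits_mul_KL {δ ε : ℝ} (hδ : 0 < δ) (hδ' : δ ≤ 1 / 2)
    (hφ : φ.Communicating) (halg : alg.IsPAC δ ε φ) (hτ : alg.sampleComplexity φ ≠ ∞)
    (hψ : ψ ∈ φ.altSet ε) :
    ENNReal.ofReal (klBernoulli δ (1 - δ)) ≤ ∑ z, alg.visits φ z * φ.KL ψ z := by
  obtain ⟨hac, hdisj⟩ := hψ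
  by_cases hfin : ∀ z, alg.visits φ z * φ.KL ψ z ≠ ∞
  swap
  · push Not at hfin
    obtain ⟨z, hz⟩ := hfin
    rw [ENNReal.sum_eq_top.2 ⟨z, Finset.mem_univ z, hz⟩]
    exact le_top
  obtain ⟨hint, hE⟩ := alg.integral_stoppedLog hac halg.stops hτ hfin
  rw [← hE]
  refine ENNReal.ofReal_le_ofReal ?_
  set s : Set (SampleSpace W S A) := {x | alg.recommend x ∈ φ.epsOptimal ε} with hsdef
  have hs : MeasurableSet[alg.isStoppingTime.measurableSpace] s :=
    alg.measurable_recommend (φ.measurableSet_epsOptimal ε)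
  have hs' : MeasurableSet s := alg.isStoppingTime.measurableSpace_le s hs
  have hA : MeasurableSet ({x | alg.τ x ≠ ⊤} ∩ s) := alg.measurableSet_stop_ne_top.inter hs'
  have hφs : 1 - δ ≤ (alg.law φ).real s := by
    have h1 : ENNReal.ofReal (1 - δ) ≤ alg.law φ s := by
      refine (halg.correct φ hφ).trans (measure_mono_ae ?_)
      filter_upwards [halg.stops] with x hx hx'
      exact hx'.resolve_left hx
    exact (ENNReal.ofReal_le_iff_le_toReal (measure_ne_top _ _)).1 h1
  -- an `ε`-optimal recommendation for `φ` is an error under `ψ`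
  have hψs : (alg.law ψ).real ({x | alg.τ x ≠ ⊤} ∩ s) ≤ δ := by
    have h1 := halg.correct ψ (hφ.of_absCont hac)
    have h2 : 1 - δ ≤ (alg.law ψ).real ({x | alg.τ x ≠ ⊤} ∩ s)ᶜ := by
      refine (ENNReal.ofReal_le_iff_le_toReal (measure_ne_top _ _)).1 (h1.trans (measure_mono ?_))
      rintro x (hx | hx) ⟨hx1, hx2⟩
      · exact hx1 hx
      · exact Set.disjoint_left.1 (Set.disjoint_iff_inter_eq_empty.2 hdisj) hx2 hx
    rw [probReal_compl_eq_one_sub hA] at h2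
    linarith
  refine klBernoulli_le_integral hδ hδ' hint hs' hφs measureReal_nonneg hψs ?_ ?_
  · rw [ofReal_measureReal]
    exact alg.setLIntegral_exp_neg_stoppedLog_le hac halg.stops hs
  · refine (alg.setLIntegral_exp_neg_stoppedLog_le hac halg.stops hs.compl).trans ?_
    rw [← probReal_compl_eq_one_sub hA, ofReal_measureReal]
    exact measure_mono fun x hx hx' => hx.2 hx'.2

end GenAlgorithm

theorem mainTheorem6 {W S A : Type*} [MeasurableSpace W]
    [Fintype S] [Nonempty S] [MeasurableSpace S] [MeasurableSingletonClass S]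
    [Fintype A] [Nonempty A] [MeasurableSpace A] [MeasurableSingletonClass A]
    (γ : Set.Ico (0 : ℝ) 1) (p₀ : ProbabilityMeasure S)
    (ε : ℝ) (hε : 0 ≤ ε) (δ : ℝ) (hδ : 0 < δ) (hδ' : δ ≤ 1 / 2)
    (φ : MDP S A γ p₀) (hφ : φ.Communicating)
    (alg : GenAlgorithm W S A) (halg : alg.IsPAC δ ε φ) :
    φ.optCharTime ε * ENNReal.ofReal (klBernoulli δ (1 - δ)) ≤ alg.sampleComplexity φ := by
  classical
  set k := ENNReal.ofReal (klBernoulli δ (1 - δ)) with hk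
  set T := alg.sampleComplexity φ with hT
  by_cases hTtop : T = ∞
  · rw [hTtop]; exact le_top
  have hinfo (ψ) (hψ : ψ ∈ φ.altSet ε) : k ≤ ∑ z, alg.visits φ z * φ.KL ψ z :=
    alg.klBernoulli_le_sum_visits_mul_KL hδ hδ' hφ halg hTtop hψ
  by_cases hT0 : T = 0
  · -- no query is made, so either there is no confusing MDP or the divergence `k` vanishes
    have hvis (z : S × A) : alg.visits φ z = 0 :=
      Finset.sum_eq_zero_iff.1 ((alg.sum_visits φ).trans hT0) z (Finset.mem_univ z)
    rcases (φ.altSet ε).eq_empty_or_nonempty with hemp | ⟨ψ, hψ⟩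
    · obtain ⟨z₀⟩ : Nonempty (S × A) := inferInstance
      have h0 : φ.optCharTime ε ≤ 0 := by
        refine (iInf_le _ (⟨Pi.single z₀ 1, single_mem_stdSimplex ℝ z₀⟩ :
          stdSimplex ℝ (S × A))).trans ?_
        simp [MDP.charTime, hemp]
      rw [nonpos_iff_eq_zero.1 h0, zero_mul]
      exact zero_le
    · have h0 : k = 0 := by simpa [hvis] using hinfo ψ hψ
      rw [h0, mul_zero]
      exact zero_le
  -- the allocation is the expected proportion of the queries spent on each pair
  have hsum : ∑ z, alg.visits φ z / T = 1 := by
    simp_rw [div_eq_mul_inv]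
    rw [← Finset.sum_mul, alg.sum_visits φ, ENNReal.mul_inv_cancel hT0 hTtop]
  have hne (z : S × A) : alg.visits φ z / T ≠ ∞ := by
    refine ne_top_of_le_ne_top ENNReal.one_ne_top ?_
    rw [← hsum]
    exact Finset.single_le_sum (f := fun z => alg.visits φ z / T) (fun _ _ => zero_le)
      (Finset.mem_univ z)
  let ω : stdSimplex ℝ (S × A) := ⟨fun z => (alg.visits φ z / T).toReal,
    fun _ => ENNReal.toReal_nonneg, by
      rw [← ENNReal.toReal_sum fun z _ => hne z, hsum, ENNReal.toReal_one]⟩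
  have hω : k / T ≤ ⨅ ψ ∈ φ.altSet ε, ∑ z, ENNReal.ofReal (ω.1 z) * φ.KL ψ z := by
    refine le_iInf₂ fun ψ hψ => ?_
    calc k / T ≤ (∑ z, alg.visits φ z * φ.KL ψ z) / T := ENNReal.div_le_div_right (hinfo ψ hψ) T
      _ = ∑ z, ENNReal.ofReal (ω.1 z) * φ.KL ψ z := by
        rw [div_eq_mul_inv, Finset.sum_mul]
        refine Finset.sum_congr rfl fun z _ => ?_
        change _ = ENNReal.ofReal (alg.visits φ z / T).toReal * _
        rw [ENNReal.ofReal_toReal (hne z), div_eq_mul_inv, mul_right_comm]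
  calc φ.optCharTime ε * k ≤ (k / T)⁻¹ * k := by
        gcongr
        exact (iInf_le _ ω).trans (ENNReal.inv_le_inv.2 hω)
    _ = T * (k⁻¹ * k) := by
        rw [ENNReal.inv_div (Or.inl hTtop) (Or.inl hT0), div_eq_mul_inv, mul_assoc]
    _ ≤ T := mul_le_of_le_one_right zero_le (ENNReal.inv_mul_le_one k)
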